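/- Throughout, a \emph{graph} is a finite connected multigraph without loop edges, and its genus is $g(G)=|E(G)|-|V(G)|+1$. For a vertex $x$, let $x(1)$ be the subgraph consisting of $x$, the vertices adjacent to $x$, and the edges incident to $x$. A \emph{morphism} $\phi:G\to G'$ is a map $V(G)\cup E(G)\to V(G')\cup E(G')$ sending vertices to vertices such that, for every edge $e$ with ends $x,y$, either $\phi(e)$ is an edge with ends $\phi(x),\phi(y)$, or $\phi(e)=\phi(x)=\phi(y)$. It is \emph{harmonic} if for every $x\in V(G)$ the number $|\phi^{-1}(e')\cap x(1)|$ does not depend on the edge $e'$ of $G'$ incident to $\phi(x)$, and \emph{non-degenerate} if $\phi(x(1))\neq\{\phi(x)\}$ for every $x\in V(G)$. For a group $\Delta$ of automorphisms of $G$, the quotient graph $G/\Delta$ has as vertices the $\Delta$-orbits of vertices of $G$ and as edges the $\Delta$-orbits of those edges of $G$ whose ends lie in distinct $\Delta$-orbits; the quotient morphism $\phi_\Delta:G\to G/\Delta$ sends vertices, and edges with ends in distinct orbits, to their orbits, and sends an edge with both ends in one vertex orbit to that vertex orbit. A group $\Gamma\le\mathrm{Aut}(G)$ \emph{acts harmonically}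 on $G$ if $\phi_\Delta$ is harmonic and non-degenerate for every subgroup $\Delta\le\Gamma$. \textbf{Proposition.} Let $g_1>1$ be an integer and let $p$ be a prime such that (i) $p>6(g_1-1)$, and (ii) $\gcd\left(\frac{p-1}{2},(g_1+1)!\right)=1$. Set $g=p(g_1-1)+1$, and let $G$ be a graph of genus $g$ with a group $\Gamma\le\mathrm{Aut}(G)$ acting harmonically on $G$. If $p$ divides $|\Gamma|$, then $|\Gamma|\le 4(g-1)$. -/

import Mathlib

namespace HarmonicGraph

/-- The genus (cyclomatic number) `|E(G)| - |V(G)| + 1` of a finite connected multigraph. -/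
noncomputable def genus {V E : Type*} (G : Graph V E) : ℤ :=
  (G.edgeSet.ncard : ℤ) - (G.vertexSet.ncard : ℤ) + 1

/-- The vertices and edges of `x(1)`, the smallest neighbourhood of the vertex `x`: the vertex `x`,
the vertices adjacent to `x`, and the edges incident to `x`. -/
def star {V E : Type*} (G : Graph V E) (x : G.vertexSet) : Set (G.vertexSet ⊕ G.edgeSet) :=
  Sum.inl '' {y | y = x ∨ G.Adj x y} ∪ Sum.inr '' {e | G.Inc e x}

/-- A morphism of multigraphs sends vertices to vertices, and sends an edge `e` with ends `x, y`
either to an edge with ends `φ(x), φ(y)` or to the vertex `φ(x) = φ(y)`. -/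
structure Morphism {V E V' E' : Type*} (G : Graph V E) (G' : Graph V' E') where
  /-- the map on vertices -/
  onVertex : G.vertexSet → G'.vertexSet
  /-- the map on edges, whose values are vertices or edges -/
  onEdge : G.edgeSet → G'.vertexSet ⊕ G'.edgeSet
  map_isLink : ∀ (e : G.edgeSet) (x y : G.vertexSet), G.IsLink e x y →
    (∃ e' : G'.edgeSet, onEdge e = Sum.inr e' ∧ G'.IsLink e' (onVertex x) (onVertex y)) ∨
      (onEdge e = Sum.inl (onVertex x) ∧ onEdge e = Sum.inl (onVertex y))

namespace Morphism

variable {V E V' E' : Type*} {G : Graph V E} {G' : Graph V' E'}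

/-- The underlying function `V(G) ∪ E(G) → V(G') ∪ E(G')`. -/
def toFun (φ : Morphism G G') : G.vertexSet ⊕ G.edgeSet → G'.vertexSet ⊕ G'.edgeSet :=
  Sum.elim (fun x => Sum.inl (φ.onVertex x)) φ.onEdge

/-- `φ` is non-degenerate if `φ(x(1)) ≠ {φ(x)}` for every vertex `x`. -/
def IsNondegenerate (φ : Morphism G G') : Prop :=
  ∀ x : G.vertexSet, φ.toFun '' star G x ≠ {Sum.inl (φ.onVertex x)}

/-- `φ` (between finite multigraphs) is harmonic if for every vertex `x` the number
`|φ⁻¹(e') ∩ x(1)|` is the same for all edges `e'` incident to `φ(x)`. -/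
def IsHarmonic (φ : Morphism G G') : Prop :=
  ∀ (x : G.vertexSet) (e₁ e₂ : G'.edgeSet),
    G'.Inc e₁ (φ.onVertex x) → G'.Inc e₂ (φ.onVertex x) →
      (φ.toFun ⁻¹' {Sum.inr e₁} ∩ star G x).ncard = (φ.toFun ⁻¹' {Sum.inr e₂} ∩ star G x).ncard

end Morphism

/-- The automorphism group of a multigraph: pairs of a permutation of the vertices and a
permutation of the edges that respect incidence. -/
def Aut {V E : Type*} (G : Graph V E) :
    Subgroup (Equiv.Perm G.vertexSet × Equiv.Perm G.edgeSet) where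
  carrier := {γ | ∀ (e : G.edgeSet) (x y : G.vertexSet),
    G.IsLink (γ.2 e) (γ.1 x) (γ.1 y) ↔ G.IsLink e x y}
  mul_mem' := by
    intro a b ha hb e x y
    exact (ha (b.2 e) (b.1 x) (b.1 y)).trans (hb e x y)
  one_mem' := by
    intro e x y
    exact Iff.rfl
  inv_mem' := by
    intro a ha e x y
    have h := ha (a.2⁻¹ e) (a.1⁻¹ x) (a.1⁻¹ y)
    simpa using h.symm

section Action

variable {V E : Type*} {G : Graph V E}

/-- Automorphisms act on the vertices. -/
instance vertexAction : MulAction (Aut G) G.vertexSet where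
  smul γ x := γ.1.1 x
  one_smul _ := rfl
  mul_smul _ _ _ := rfl

/-- Automorphisms act on the edges. -/
instance edgeAction : MulAction (Aut G) G.edgeSet where
  smul γ e := γ.1.2 e
  one_smul _ := rfl
  mul_smul _ _ _ := rfl

theorem isLink_smul (γ : Aut G) (e : G.edgeSet) (x y : G.vertexSet) :
    G.IsLink (γ • e : G.edgeSet) (γ • x : G.vertexSet) (γ • y : G.vertexSet) ↔ G.IsLink e x y :=
  γ.2 e x y

/-- The orbit `Δ x` of a vertex. -/
def vertexOrbit (Δ : Subgroup (Aut G)) (x : G.vertexSet) :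
    MulAction.orbitRel.Quotient Δ G.vertexSet :=
  Quotient.mk (MulAction.orbitRel Δ G.vertexSet) x

/-- The orbit `Δ e` of an edge. -/
def edgeOrbit (Δ : Subgroup (Aut G)) (e : G.edgeSet) :
    MulAction.orbitRel.Quotient Δ G.edgeSet :=
  Quotient.mk (MulAction.orbitRel Δ G.edgeSet) e

theorem vertexOrbit_smul (Δ : Subgroup (Aut G)) (δ : Δ) (x : G.vertexSet) :
    vertexOrbit Δ (δ • x) = vertexOrbit Δ x :=
  Quotient.sound (MulAction.orbitRel_apply.2 (MulAction.mem_orbit x δ))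

/-- Ends of edges in the same orbit lie in the same pair of orbits. -/
theorem orbit_eq_or_eq (Δ : Subgroup (Aut G)) {e e' : G.edgeSet} {x y x' y' : G.vertexSet}
    (h : G.IsLink e x y) (h' : G.IsLink e' x' y') (he : edgeOrbit Δ e = edgeOrbit Δ e') :
    (vertexOrbit Δ x = vertexOrbit Δ x' ∧ vertexOrbit Δ y = vertexOrbit Δ y') ∨
      (vertexOrbit Δ x = vertexOrbit Δ y' ∧ vertexOrbit Δ y = vertexOrbit Δ x') := by
  obtain ⟨δ, rfl⟩ : ∃ δ : Δ, δ • e' = e :=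
    MulAction.mem_orbit_iff.1 (MulAction.orbitRel_apply.1 (Quotient.exact he))
  have h2 := (isLink_smul (δ : Aut G) e' x' y').2 h'
  rcases h.eq_and_eq_or_eq_and_eq h2 with ⟨h3, h4⟩ | ⟨h3, h4⟩
  · obtain rfl : x = δ • x' := Subtype.ext h3
    obtain rfl : y = δ • y' := Subtype.ext h4
    exact Or.inl ⟨vertexOrbit_smul Δ δ x', vertexOrbit_smul Δ δ y'⟩
  · obtain rfl : x = δ • y' := Subtype.ext h3
    obtain rfl : y = δ • x' := Subtype.ext h4
    exact Or.inr ⟨vertexOrbit_smul Δ δ y', vertexOrbit_smul Δ δ x'⟩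

/-- The quotient graph `G/Δ`: its vertices are the orbits of vertices, and its edges are the orbits
of those edges whose ends lie in distinct orbits. -/
def quotientGraph (Δ : Subgroup (Aut G)) :
    Graph (MulAction.orbitRel.Quotient Δ G.vertexSet)
      (MulAction.orbitRel.Quotient Δ G.edgeSet) where
  vertexSet := Set.univ
  IsLink f X Y := X ≠ Y ∧ ∃ (e : G.edgeSet) (x y : G.vertexSet), G.IsLink e x y ∧
    edgeOrbit Δ e = f ∧ vertexOrbit Δ x = X ∧ vertexOrbit Δ y = Y
  isLink_symm := by
    rintro f -
    refine ⟨?_⟩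
    rintro X Y ⟨hne, e, x, y, h, he, hx, hy⟩
    exact ⟨hne.symm, e, y, x, h.symm, he, hy, hx⟩
  eq_or_eq_of_isLink_of_isLink := by
    rintro f X Y Z W ⟨-, e, x, y, h, he, rfl, rfl⟩ ⟨-, e', x', y', h', he', rfl, rfl⟩
    rcases orbit_eq_or_eq Δ h h' (he.trans he'.symm) with ⟨h1, -⟩ | ⟨h1, -⟩
    · exact Or.inl h1
    · exact Or.inr h1
  left_mem_of_isLink := fun _ _ _ _ => Set.mem_univ _

/-- An end of an edge. -/
noncomputable def someEnd (e : G.edgeSet) : G.vertexSet :=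
  ⟨(G.exists_isLink_of_mem_edgeSet e.2).choose,
    (G.exists_isLink_of_mem_edgeSet e.2).choose_spec.choose_spec.left_mem⟩

theorem someEnd_eq_or_eq {e : G.edgeSet} {x y : G.vertexSet} (h : G.IsLink e x y) :
    someEnd e = x ∨ someEnd e = y := by
  have h1 := (G.exists_isLink_of_mem_edgeSet e.2).choose_spec.choose_spec.left_eq_or_eq h
  exact h1.imp (fun h2 => Subtype.ext h2) (fun h2 => Subtype.ext h2)

open Classical in
/-- The quotient morphism `G → G/Δ`, sending a vertex to its orbit, an edge with ends in distinct
orbits to its orbit, and an edge with both ends in one orbit to that orbit. -/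
noncomputable def quotientMap (Δ : Subgroup (Aut G)) : Morphism G (quotientGraph Δ) where
  onVertex x := ⟨vertexOrbit Δ x, Set.mem_univ _⟩
  onEdge e :=
    if h : edgeOrbit Δ e ∈ (quotientGraph Δ).edgeSet then Sum.inr ⟨edgeOrbit Δ e, h⟩
    else Sum.inl ⟨vertexOrbit Δ (someEnd e), Set.mem_univ _⟩
  map_isLink := by
    intro e x y hl
    by_cases h : edgeOrbit Δ e ∈ (quotientGraph Δ).edgeSet
    · refine Or.inl ⟨⟨edgeOrbit Δ e, h⟩, by simp [h], ?_⟩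
      obtain ⟨X, Y, hne, e', x', y', h', he', rfl, rfl⟩ := h
      refine ⟨?_, e, x, y, hl, rfl, rfl, rfl⟩
      change vertexOrbit Δ x ≠ vertexOrbit Δ y
      rcases orbit_eq_or_eq Δ hl h' he'.symm with ⟨h1, h2⟩ | ⟨h1, h2⟩
      · rw [h1, h2]; exact hne
      · rw [h1, h2]; exact hne.symm
    · have hxy : vertexOrbit Δ x = vertexOrbit Δ y := by
        by_contra hne
        exact h ⟨_, _, hne, e, x, y, hl, rfl, rfl, rfl⟩
      refine Or.inr ?_
      rcases someEnd_eq_or_eq hl with h1 | h1 <;> simp [h, h1, hxy]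

/-- A group `Γ` of automorphisms of a finite multigraph `G` acts harmonically if for every subgroup
`Δ` of `Γ` the quotient morphism `G → G/Δ` is harmonic and non-degenerate. -/
def ActsHarmonically (Γ : Subgroup (Aut G)) : Prop :=
  ∀ Δ : Subgroup (Aut G), Δ ≤ Γ → (quotientMap Δ).IsHarmonic ∧ (quotientMap Δ).IsNondegenerate

end Action

end HarmonicGraph

/-!
A nontrivial automorphism `γ` in a group `Γ` acting harmonically never fixes a vertex together with
an edge at it. Indeed, if `γ` fixes a vertex `x`, then no edge at `x` is contracted in the quotient
by `⟨γ⟩`; if `γ` also fixes an edge at `x`, then harmonicity says that all fibres at `x` are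
singletons, so `γ` fixes every edge at `x` (`smul_edge_eq_of_flag`), and by connectedness it is
trivial (`eq_one_of_fixes_flag`). Everything else uses only this freeness on flags (`IsFlagFree`).

Counting vertices and flags by orbits gives a Riemann–Hurwitz formula: `2 (g - 1) = T |Γ|` with
`T + 2 = 2 b + w + ∑ (2 - 2 / mᵢ)`, where `b` is the first Betti number of the quotient graph, `w`
the number of orbits of vertical flags, and `mᵢ` the orders of the vertex stabilizers
(`IsFlagFree.riemann_hurwitz`, `excess_eq`). If `|Γ| > 4 (g - 1)`, then `0 < T < 1/2`, and the only
such value is `T = 1/3` (`excess_eq_third`). Hence `|Γ| = 6 (g - 1) = p s`, where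
`s = 6 (g₁ - 1) < p`.

By Sylow's theorem the subgroup `P` of order `p` is normal in `Γ`. The index of its centralizer `C`
divides both `s` and `p - 1`, and `(p - 1) / 2` is coprime to `s`, as `s` has no prime factor above
`g₁ + 1`; so the index is at most two (`index_centralizer_dvd_two`). Thus the action of `C` has
excess at most `2/3`. This forces the quotient by `C` to be a tree whose vertical edges are all
reversed by `C` (`tree_of_excess_lt_one`), and the vertex stabilizers to have order less than `7`
(`stabilizer_lt_seven`). An Euler characteristic count then shows that `C` is generated by its
vertex stabilizers and its involutions (`IsFlagFree.eq_top_of_tree`), all of order prime to `p`. On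
the other hand `P` is a central Sylow subgroup of `C`, and the kernel of the transfer `C → P` is a
proper subgroup containing all elements of order prime to `p` (`exists_ne_top_of_central`), a
contradiction.
-/

namespace HarmonicGraph

open MulAction

/-! ### Orbit counting -/

section Counting

variable {H X Y : Type*} [Group H] [MulAction H X] [MulAction H Y]

/-- The orbit-counting lemma, summed over points instead of group elements. -/
theorem sum_card_stabilizer (H Y : Type*) [Group H] [MulAction H Y] [Finite H] [Fintype Y] :
    ∑ y : Y, Nat.card (stabilizer H y) = Nat.card (orbitRel.Quotient H Y) * Nat.card H := by
  classical
  rw [← Nat.card_sigma, ← Nat.card_prod]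
  refine Nat.card_congr (Equiv.trans ?_ (sigmaFixedByEquivOrbitsProdGroup H Y))
  exact
    { toFun := fun q => ⟨q.2.1, q.1, q.2.2⟩
      invFun := fun q => ⟨q.2.1, q.1, q.2.2⟩
      left_inv := fun _ => rfl
      right_inv := fun _ => rfl }

theorem card_eq_of_free [Finite H] [Finite Y] (hfree : ∀ (h : H) (y : Y), h • y = y → h = 1) :
    Nat.card Y = Nat.card H * Nat.card (orbitRel.Quotient H Y) := by
  have := Fintype.ofFinite Y
  have h1 := sum_card_stabilizer H Y
  have h2 : ∀ y : Y, Nat.card (stabilizer H y) = 1 := fun y => by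
    rw [(Subgroup.eq_bot_iff_forall (stabilizer H y)).2 fun h hh => hfree h y hh,
      Subgroup.card_bot]
  simp only [h2, Finset.sum_const, Finset.card_univ, smul_eq_mul, mul_one] at h1
  rw [Nat.card_eq_fintype_card, h1, mul_comm]

/-- The class equation with rational summands. -/
theorem card_eq_sum_orbits (H X : Type*) [Group H] [MulAction H X] [Finite H] [Finite X]
    [Fintype (orbitRel.Quotient H X)] :
    (Nat.card X : ℚ) =
      Nat.card H * ∑ ω : orbitRel.Quotient H X, 1 / (Nat.card (stabilizer H ω.out) : ℚ) := by
  classical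
  have := Fintype.ofFinite X
  have := Fintype.ofFinite H
  rw [Nat.card_eq_fintype_card, card_eq_sum_card_group_div_card_stabilizer H X, Nat.cast_sum,
    Finset.mul_sum]
  refine Finset.sum_congr rfl fun ω _ => ?_
  rw [← Nat.card_eq_fintype_card, ← Nat.card_eq_fintype_card,
    Nat.cast_div (Subgroup.card_subgroup_dvd_card _) (by exact_mod_cast Nat.card_pos.ne'),
    mul_one_div]

theorem card_subtype_mem_sym2 {α : Type*} (z : Sym2 α) (hz : ¬ z.IsDiag) :
    Nat.card {x // x ∈ z} = 2 := by
  classical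
  rw [← Sym2.card_toFinset_of_not_isDiag z hz]
  exact Nat.subtype_card z.toFinset fun x => by simp

end Counting

/-! ### Flag-free actions and their quotient graphs -/

/-- An action of `H` on a connected loopless multigraph with vertices `X` and edges `Y`, given by
the map `ends` from edges to unordered pairs of vertices, such that only the identity fixes a flag,
that is, a vertex together with an edge incident to it. -/
structure IsFlagFree (H : Type*) {X Y : Type*} [Group H] [MulAction H X] [MulAction H Y]
    (ends : Y → Sym2 X) : Prop where
  ends_smul : ∀ (h : H) (e : Y), ends (h • e) = (ends e).map (h • ·)
  not_isDiag : ∀ e, ¬ (ends e).IsDiag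
  eq_one : ∀ (h : H) (x : X) (e : Y), x ∈ ends e → h • x = x → h • e = e → h = 1
  connected : (SimpleGraph.fromEdgeSet (Set.range ends)).Connected

section Quotient

variable (H : Type*) {X Y : Type*} [Group H] [MulAction H X] [MulAction H Y] {ends : Y → Sym2 X}

/-- The pair of vertex orbits containing the ends of an edge. -/
def orbitEnds (ends : Y → Sym2 X) (e : Y) : Sym2 (orbitRel.Quotient H X) :=
  (ends e).map (Quotient.mk (orbitRel H X))

namespace IsFlagFree

variable {H}

theorem subgroup (hH : IsFlagFree H ends) (K : Subgroup H) : IsFlagFree K ends where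
  ends_smul k e := hH.ends_smul k e
  not_isDiag := hH.not_isDiag
  eq_one k x e hx hkx hke := Subtype.ext (hH.eq_one k x e hx hkx hke)
  connected := hH.connected

theorem orbitEnds_smul (hH : IsFlagFree H ends) (h : H) (e : Y) :
    orbitEnds H ends (h • e) = orbitEnds H ends e := by
  unfold orbitEnds
  rw [hH.ends_smul, Sym2.map_map]
  congr 1
  funext x
  exact Quotient.sound (mem_orbit x h)

/-- The crossing edges, those whose ends lie in distinct orbits. -/
def crossingEdges (hH : IsFlagFree H ends) : SubMulAction H Y where
  carrier := {e | ¬ (orbitEnds H ends e).IsDiag}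
  smul_mem' h e he := by rwa [Set.mem_ofPred_eq, hH.orbitEnds_smul]

/-- The flags whose edge has both ends in one orbit. -/
def verticalFlags (hH : IsFlagFree H ends) : SubMulAction H (X × Y) where
  carrier := {f | f.1 ∈ ends f.2 ∧ (orbitEnds H ends f.2).IsDiag}
  smul_mem' h f hf := by
    refine ⟨?_, ?_⟩
    · rw [Prod.smul_snd, hH.ends_smul]
      exact Sym2.mem_map.2 ⟨f.1, hf.1, rfl⟩
    · rw [Prod.smul_snd, hH.orbitEnds_smul]
      exact hf.2

/-- An element fixing a crossing edge cannot exchange its ends. -/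
theorem crossingEdges_free (hH : IsFlagFree H ends) (h : H) (e : hH.crossingEdges)
    (he : h • e = e) : h = 1 := by
  obtain ⟨e, hc⟩ := e
  have he' : h • e = e := congrArg Subtype.val he
  have h1 := hH.ends_smul h e
  change ¬ (orbitEnds H ends e).IsDiag at hc
  unfold orbitEnds at hc
  have h2 := hH.eq_one h
  induction hz : ends e with | _ x y
  rw [he', hz] at h1
  rw [hz] at hc
  rw [Sym2.map_mk, Sym2.eq_iff] at h1
  rcases h1 with ⟨hx, -⟩ | ⟨hx, -⟩
  · exact h2 x e (by simp [hz]) hx.symm he'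
  · refine absurd ?_ hc
    rw [Sym2.map_mk, Sym2.mk_isDiag_iff, hx]
    exact Quotient.sound (mem_orbit y h)

theorem verticalFlags_free (hH : IsFlagFree H ends) (h : H) (f : hH.verticalFlags)
    (hf : h • f = f) : h = 1 := by
  have hf' : h • (f : X × Y) = f := congrArg Subtype.val hf
  exact hH.eq_one h f.1.1 f.1.2 f.2.1 (congrArg Prod.fst hf') (congrArg Prod.snd hf')

/-- The number of orbits of crossing edges, that is, of edges of the quotient graph. -/
noncomputable def numCrossing (hH : IsFlagFree H ends) : ℕ :=
  Nat.card (orbitRel.Quotient H hH.crossingEdges)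

/-- The number of orbits of vertical flags. An orbit of edges joining vertices of one orbit
contributes `1` if its edges are reversed by elements of the group, and `2` otherwise. -/
noncomputable def numVertical (hH : IsFlagFree H ends) : ℕ :=
  Nat.card (orbitRel.Quotient H hH.verticalFlags)

theorem card_crossingEdges [Finite H] [Finite Y] (hH : IsFlagFree H ends) :
    Nat.card hH.crossingEdges = Nat.card H * hH.numCrossing :=
  card_eq_of_free hH.crossingEdges_free

/-- Counting flags: each crossing edge carries two of them, and the group acts freely on the
crossing edges and on the vertical flags. -/
theorem two_mul_card_edges [Finite H] [Finite X] [Finite Y] (hH : IsFlagFree H ends) :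
    2 * Nat.card Y = Nat.card H * (2 * hH.numCrossing + hH.numVertical) := by
  classical
  have := Fintype.ofFinite Y
  have h1 : Nat.card hH.verticalFlags = Nat.card H * hH.numVertical :=
    card_eq_of_free hH.verticalFlags_free
  have h2 : Nat.card hH.verticalFlags =
      Nat.card {e : Y // (orbitEnds H ends e).IsDiag} * 2 := by
    have φ : hH.verticalFlags ≃
        Σ e : {e : Y // (orbitEnds H ends e).IsDiag}, {x // x ∈ ends e} :=
      { toFun := fun f => ⟨⟨f.1.2, f.2.2⟩, f.1.1, f.2.1⟩
        invFun := fun q => ⟨(q.2.1, q.1.1), q.2.2, q.1.2⟩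
        left_inv := fun _ => rfl
        right_inv := fun _ => rfl }
    rw [Nat.card_congr φ, Nat.card_sigma]
    simp [card_subtype_mem_sym2 _ (hH.not_isDiag _)]
  have h3 : Nat.card Y = Nat.card {e : Y // (orbitEnds H ends e).IsDiag} +
      Nat.card hH.crossingEdges := by
    rw [← Nat.card_congr (Equiv.sumCompl fun e : Y => (orbitEnds H ends e).IsDiag), Nat.card_sum]
    rfl
  rw [hH.card_crossingEdges] at h3
  rw [mul_add, ← h1, h2, h3]
  ring

/-- The simple graph underlying the quotient graph is connected. -/
theorem connected_quotient (hH : IsFlagFree H ends) :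
    (SimpleGraph.fromEdgeSet (Set.range (orbitEnds H ends))).Connected := by
  have hne := hH.connected.nonempty
  have hne' : Nonempty (orbitRel.Quotient H X) := hne.map (Quotient.mk _)
  refine SimpleGraph.Connected.mk ?_
  intro a b
  induction a using Quotient.inductionOn with | _ x
  induction b using Quotient.inductionOn with | _ y
  obtain ⟨w⟩ := hH.connected.preconnected x y
  induction w with
  | nil => exact SimpleGraph.Reachable.refl _
  | @cons u v t huv w ih =>
    refine SimpleGraph.Reachable.trans ?_ ih
    obtain ⟨⟨e, he⟩, -⟩ := huv
    by_cases h : (Quotient.mk (orbitRel H X) u) = Quotient.mk (orbitRel H X) v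
    · rw [h]
    · exact SimpleGraph.Adj.reachable ⟨⟨e, by rw [orbitEnds, he, Sym2.map_mk]⟩, h⟩

/-- A connected graph has at most one vertex more than edges; here for the quotient graph. -/
theorem card_orbits_le [Finite H] [Finite X] [Finite Y] (hH : IsFlagFree H ends) :
    Nat.card (orbitRel.Quotient H X) ≤ hH.numCrossing + 1 := by
  refine hH.connected_quotient.card_vert_le_card_edgeSet_add_one.trans ?_
  refine Nat.add_le_add_right ?_ 1
  -- each edge of the quotient is the image of an orbit of crossing edges
  refine Nat.card_le_card_of_surjective
    (Quotient.lift (fun e : hH.crossingEdges => (⟨orbitEnds H ends e, ?_⟩ :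
      (SimpleGraph.fromEdgeSet (Set.range (orbitEnds H ends))).edgeSet)) ?_) ?_
  · rw [SimpleGraph.edgeSet_fromEdgeSet]
    exact ⟨⟨e, rfl⟩, e.2⟩
  · rintro a b ⟨h, rfl⟩
    exact Subtype.ext (hH.orbitEnds_smul h b)
  · rintro ⟨z, hz⟩
    have hz' := hz
    rw [SimpleGraph.edgeSet_fromEdgeSet] at hz'
    obtain ⟨⟨e, rfl⟩, hd⟩ := hz'
    exact ⟨Quotient.mk _ ⟨e, hd⟩, rfl⟩

/-- If there is at most one orbit of vertical flags, then the two flags of a vertical edge are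
exchanged by an element of the group, which is an involution since its square fixes a flag. -/
theorem exists_reversing (hH : IsFlagFree H ends) (hv : hH.numVertical ≤ 1) [Finite H] [Finite X]
    [Finite Y] {e : Y} {x y : X} (hxy : ends e = s(x, y)) (he : (orbitEnds H ends e).IsDiag) :
    ∃ h : H, h • y = x ∧ h ^ 2 = 1 := by
  have hs : Subsingleton (orbitRel.Quotient H hH.verticalFlags) :=
    Finite.card_le_one_iff_subsingleton.1 hv
  let f₁ : hH.verticalFlags := ⟨(x, e), by simp [hxy], he⟩
  let f₂ : hH.verticalFlags := ⟨(y, e), by simp [hxy], he⟩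
  obtain ⟨h, hh⟩ := Quotient.exact (hs.elim (Quotient.mk _ f₁) (Quotient.mk _ f₂))
  have hh' : h • ((y, e) : X × Y) = (x, e) := congrArg Subtype.val hh
  have h1 : h • y = x := congrArg Prod.fst hh'
  have h2 : h • e = e := congrArg Prod.snd hh'
  have h3 := hH.ends_smul h e
  rw [h2, hxy, Sym2.map_mk, Sym2.eq_iff, h1] at h3
  have h4 : h • x = y := by
    rcases h3 with ⟨h5, h6⟩ | ⟨-, h6⟩
    · exact h5.symm.trans h6.symm
    · exact h6.symm
  refine ⟨h, h1, hH.eq_one _ x e (by simp [hxy]) ?_ ?_⟩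
  · rw [pow_two, mul_smul, h4, h1]
  · rw [pow_two, mul_smul, h2, h2]

/-- If the quotient graph is a tree and every vertical edge is reversed by the group, then the
group is generated by the vertex stabilizers and the involutions: for a subgroup `K` containing
these, passing from the quotient by the group to the quotient by `K` multiplies the numbers of
vertices and of edges by the index of `K`, whereas a connected graph with `h` edges has at most
`h + 1` vertices. -/
theorem eq_top_of_tree [Finite H] [Finite X] [Finite Y] (hH : IsFlagFree H ends)
    (htree : Nat.card (orbitRel.Quotient H X) = hH.numCrossing + 1) (hv : hH.numVertical ≤ 1)
    (K : Subgroup H) (hstab : ∀ (h : H) (x : X), h • x = x → h ∈ K)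
    (hinv : ∀ h : H, h ^ 2 = 1 → h ∈ K) : K = ⊤ := by
  have := Fintype.ofFinite X
  have hK := hH.subgroup K
  have hvert : Nat.card (orbitRel.Quotient K X) * Nat.card K =
      Nat.card (orbitRel.Quotient H X) * Nat.card H := by
    rw [← sum_card_stabilizer, ← sum_card_stabilizer]
    refine Finset.sum_congr rfl fun x _ => Nat.card_congr ?_
    exact
      { toFun := fun k => ⟨k.1, k.2⟩
        invFun := fun h => ⟨⟨h.1, hstab h.1 x h.2⟩, h.2⟩
        left_inv := fun _ => rfl
        right_inv := fun _ => rfl }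
  have hdiag : ∀ e : Y, (orbitEnds K ends e).IsDiag ↔ (orbitEnds H ends e).IsDiag := by
    intro e
    obtain ⟨⟨x, y⟩, hz⟩ := Quot.exists_rep (ends e)
    have hz' : ends e = s(x, y) := hz.symm
    constructor
    · intro h
      rw [orbitEnds, hz', Sym2.map_mk, Sym2.mk_isDiag_iff] at h ⊢
      obtain ⟨k, hk⟩ := Quotient.exact h
      exact Quotient.sound ⟨k, hk⟩
    · intro h
      obtain ⟨c, hc, hc2⟩ := hH.exists_reversing hv hz' h
      rw [orbitEnds, hz', Sym2.map_mk, Sym2.mk_isDiag_iff]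
      exact Quotient.sound ⟨⟨c, hinv c hc2⟩, hc⟩
  have hedge : Nat.card K * hK.numCrossing = Nat.card H * hH.numCrossing := by
    rw [← card_crossingEdges, ← card_crossingEdges]
    exact Nat.card_congr (Equiv.subtypeEquivRight fun e => not_congr (hdiag e))
  have hle : Nat.card (orbitRel.Quotient K X) * Nat.card K ≤
      (hK.numCrossing + 1) * Nat.card K := Nat.mul_le_mul_right _ hK.card_orbits_le
  refine Subgroup.eq_top_of_le_card K ?_
  rw [hvert, htree] at hle
  linarith

end IsFlagFree

end Quotient

/-! ### The arithmetic of the Riemann–Hurwitz formula -/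

section Numeric

variable {Ω : Type*} [Fintype Ω] {m : Ω → ℕ} {h w : ℕ} {T : ℚ}

/-- The excess is the number `T` with `2 (g - 1) = T |Γ|`. Here `m` gives the orders of the vertex
stabilizers, one for each vertex orbit, `h` is the number of edges of the quotient graph, and `w`
is the number of orbits of vertical flags. The right-hand side separates three contributions which
are nonnegative: the first Betti number of the quotient graph, `w`, and the branch terms
`2 - 2 / m i`. -/
theorem excess_eq (hT : T = 2 * h + w - 2 * ∑ i, 1 / (m i : ℚ)) :
    T + 2 = 2 * ((h + 1 : ℚ) - Fintype.card Ω) + w + ∑ i, (2 - 2 / (m i : ℚ)) := by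
  have : ∑ i, (2 - 2 / (m i : ℚ)) = 2 * Fintype.card Ω - 2 * ∑ i, 1 / (m i : ℚ) := by
    rw [Finset.sum_sub_distrib, Finset.mul_sum]
    simp [mul_comm, div_eq_mul_inv]
  rw [this, hT]
  ring

theorem branch_nonneg {n : ℕ} (hn : 0 < n) : (0 : ℚ) ≤ 2 - 2 / n := by
  have h1 : (1 : ℚ) ≤ n := by exact_mod_cast hn
  have : (2 : ℚ) / n ≤ 2 := div_le_self (by norm_num) h1
  linarith

theorem branch_ge {n k : ℕ} (hk : 0 < k) (hn : k ≤ n) : (2 : ℚ) - 2 / k ≤ 2 - 2 / n := by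
  have hk' : (0 : ℚ) < k := by exact_mod_cast hk
  have h1 : (k : ℚ) ≤ n := by exact_mod_cast hn
  have : (2 : ℚ) / n ≤ 2 / k := by gcongr
  linarith

theorem one_le_branch {n : ℕ} (hn : 2 ≤ n) : (1 : ℚ) ≤ 2 - 2 / n := by
  have := branch_ge (by norm_num) hn
  norm_num at this ⊢
  linarith

theorem branch_lt {n : ℕ} (hn : 0 < n) : (2 : ℚ) - 2 / n < 2 := by
  have h1 : (0 : ℚ) < n := by exact_mod_cast hn
  have : (0 : ℚ) < 2 / n := by positivity
  linarith

/-- A branch term is either zero or at least one. -/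
theorem branch_eq_zero_or {n : ℕ} (hn : 0 < n) : (2 : ℚ) - 2 / n = 0 ∨ 2 ≤ n := by
  rcases (show n = 1 ∨ 2 ≤ n by omega) with rfl | h
  · left; norm_num
  · exact Or.inr h

theorem branch_sum_eq_zero_or (hm : ∀ i, 0 < m i) :
    ∑ i, (2 - 2 / (m i : ℚ)) = 0 ∨ 1 ≤ ∑ i, (2 - 2 / (m i : ℚ)) := by
  by_cases h : ∃ i, 2 ≤ m i
  · obtain ⟨i, hi⟩ := h
    right
    exact (one_le_branch hi).trans
      (Finset.single_le_sum (f := fun i => (2 : ℚ) - 2 / (m i : ℚ))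
        (fun j _ => branch_nonneg (hm j)) (Finset.mem_univ i))
  · left
    push Not at h
    refine Finset.sum_eq_zero fun i _ => ?_
    rcases branch_eq_zero_or (hm i) with h1 | h1
    · exact h1
    · exact absurd (h i) (not_lt.2 h1)

/-- When the excess lies strictly between `0` and `1`, the quotient graph is a tree and at most
one orbit of vertical flags occurs. -/
theorem tree_of_excess_lt_one (hm : ∀ i, 0 < m i)
    (hT : T = 2 * h + w - 2 * ∑ i, 1 / (m i : ℚ)) (hk : Fintype.card Ω ≤ h + 1)
    (h0 : 0 < T) (h1 : T < 1) : Fintype.card Ω = h + 1 ∧ w ≤ 1 := by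
  have he := excess_eq hT
  obtain ⟨b, hb⟩ := Nat.exists_eq_add_of_le hk
  have hb' : (h + 1 : ℚ) = Fintype.card Ω + b := by exact_mod_cast hb
  rw [hb', add_sub_cancel_left] at he
  rcases branch_sum_eq_zero_or hm with hS | hS
  · -- without branching the excess would be an integer
    exfalso
    rw [hS] at he
    have h2 : (2 : ℚ) < (2 * b + w : ℕ) := by push_cast; linarith
    have h3 : ((2 * b + w : ℕ) : ℚ) < 3 := by push_cast; linarith
    norm_cast at h2 h3
    omega
  · have h3 : ((2 * b + w : ℕ) : ℚ) < 2 := by push_cast; linarith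
    norm_cast at h3
    exact ⟨by omega, by omega⟩

/-- The value `7` is the least order of a stabilizer which is too large for the excess `2/3`. -/
theorem stabilizer_lt_seven (hm : ∀ i, 0 < m i)
    (hT : T = 2 * h + w - 2 * ∑ i, 1 / (m i : ℚ)) (hk : Fintype.card Ω ≤ h + 1)
    (h0 : 0 < T) (h1 : T ≤ 2 / 3) (i : Ω) : m i < 7 := by
  classical
  by_contra! hi
  obtain ⟨hc, hw⟩ := tree_of_excess_lt_one hm hT hk h0 (by linarith)
  have he := excess_eq hT
  have hc' : (Fintype.card Ω : ℚ) = h + 1 := by exact_mod_cast hc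
  rw [hc', sub_self, mul_zero, zero_add, ← Finset.add_sum_erase _ _ (Finset.mem_univ i)] at he
  have h7 := branch_ge (by norm_num) hi
  have h2 := branch_lt (hm i)
  norm_num at h7
  have hnn : 0 ≤ ∑ j ∈ Finset.univ.erase i, (2 - 2 / (m j : ℚ)) :=
    Finset.sum_nonneg fun j _ => branch_nonneg (hm j)
  interval_cases w
  · rw [Nat.cast_zero, zero_add] at he
    -- the other branch terms sum to less than one, hence vanish
    have hz : ∑ j ∈ Finset.univ.erase i, (2 - 2 / (m j : ℚ)) = 0 := by
      refine Finset.sum_eq_zero fun j hj => ?_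
      rcases branch_eq_zero_or (hm j) with h3 | h3
      · exact h3
      · have := Finset.single_le_sum (f := fun i => (2 : ℚ) - 2 / (m i : ℚ))
          (fun j _ => branch_nonneg (hm j)) hj
        have := one_le_branch h3
        linarith
    rw [hz, add_zero] at he
    linarith
  · rw [Nat.cast_one] at he
    linarith

/-- The excess takes no value in the interval `(0, 1/2)` other than `1/3`. -/
theorem excess_eq_third (hm : ∀ i, 0 < m i)
    (hT : T = 2 * h + w - 2 * ∑ i, 1 / (m i : ℚ)) (hk : Fintype.card Ω ≤ h + 1)
    (h0 : 0 < T) (h1 : T < 1 / 2) : T = 1 / 3 := by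
  classical
  obtain ⟨hc, hw⟩ := tree_of_excess_lt_one hm hT hk h0 (by linarith)
  have he := excess_eq hT
  have hc' : (Fintype.card Ω : ℚ) = h + 1 := by exact_mod_cast hc
  rw [hc', sub_self, mul_zero, zero_add] at he
  have hex : ∀ s : Finset Ω, 0 < ∑ i ∈ s, (2 - 2 / (m i : ℚ)) → ∃ i ∈ s, 2 ≤ m i := by
    intro s hs
    obtain ⟨i, hi, hi'⟩ := Finset.exists_ne_zero_of_sum_ne_zero hs.ne'
    exact ⟨i, hi, (branch_eq_zero_or (hm i)).resolve_left hi'⟩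
  have hw' : (w : ℚ) ≤ 1 := by exact_mod_cast hw
  obtain ⟨i, -, hi⟩ := hex Finset.univ (by linarith)
  rw [← Finset.add_sum_erase _ _ (Finset.mem_univ i)] at he
  set s := Finset.univ.erase i
  have hi1 := one_le_branch hi
  have hi2 := branch_lt (hm i)
  have hpos : ∀ t : Finset Ω, 0 ≤ ∑ j ∈ t, (2 - 2 / (m j : ℚ)) := fun t =>
    Finset.sum_nonneg fun j _ => branch_nonneg (hm j)
  have hsing : ∀ (t : Finset Ω) (j : Ω), j ∈ t → 2 ≤ m j → 1 ≤ ∑ j ∈ t, (2 - 2 / (m j : ℚ)) :=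
    fun t j hj hj2 => (one_le_branch hj2).trans
      (Finset.single_le_sum (f := fun i => (2 : ℚ) - 2 / (m i : ℚ))
        (fun j _ => branch_nonneg (hm j)) hj)
  have hzero : ∀ t : Finset Ω, ∑ j ∈ t, (2 - 2 / (m j : ℚ)) < 1 →
      ∑ j ∈ t, (2 - 2 / (m j : ℚ)) = 0 := by
    intro t ht
    by_contra hne
    obtain ⟨j, hj, hj2⟩ := hex t (lt_of_le_of_ne (hpos t) (Ne.symm hne))
    exact absurd (hsing t j hj hj2) (not_le.2 ht)
  -- a branch term above `1` belongs to an order at least `3`, and one below `3/2` to an order at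
  -- most `3`
  have hlow : ∀ j, 1 < (2 - 2 / (m j : ℚ)) → 3 ≤ m j := by
    intro j hj
    by_contra! hlt
    have hmj := hm j
    interval_cases m j <;> norm_num at hj
  have hhigh : ∀ j, (2 - 2 / (m j : ℚ)) < 3 / 2 → m j ≤ 3 := by
    intro j hj
    by_contra! hlt
    have := branch_ge (by norm_num) (show 4 ≤ m j from hlt)
    norm_num at this
    linarith
  interval_cases w
  · -- two nontrivial stabilizers, of orders `2` and `3`
    rw [Nat.cast_zero, zero_add] at he
    obtain ⟨j, hj, hj2⟩ := hex s (by linarith)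
    rw [← Finset.add_sum_erase _ _ hj] at he
    have hj1 := one_le_branch hj2
    have hr := hpos (s.erase j)
    have hz := hzero (s.erase j) (by linarith)
    rw [hz] at he
    have hi3 := hhigh i (by linarith)
    have hj3 := hhigh j (by linarith)
    interval_cases m i <;> interval_cases m j <;> norm_num at he <;> linarith
  · -- a single nontrivial stabilizer, of order `3`
    rw [Nat.cast_one] at he
    have hz := hzero s (by linarith)
    rw [hz] at he
    have hi3 := hhigh i (by linarith)
    have hi4 := hlow i (by linarith)
    have h3 : m i = 3 := le_antisymm hi3 hi4
    rw [h3] at he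
    norm_num at he
    linarith

end Numeric

/-! ### Finite groups with a normal subgroup of large prime order -/

/-- In a group of order `p s` with `s < p` the Sylow `p`-subgroup is normal, since the number of
Sylow `p`-subgroups divides `s` and is congruent to `1` modulo `p`. -/
theorem sylow_normal_of_card_eq {Γ : Type*} [Group Γ] [Finite Γ] {p s : ℕ} [hp : Fact p.Prime]
    (hs0 : 0 < s) (hs : s < p) (hcard : Nat.card Γ = p * s) (P : Sylow p Γ) :
    (P : Subgroup Γ).Normal ∧ Nat.card P = p ∧ (P : Subgroup Γ).index = s := by
  have hps : ¬ p ∣ s := fun h => absurd (Nat.le_of_dvd hs0 h) (not_le.2 hs)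
  have hP : Nat.card P = p := by
    rw [P.card_eq_multiplicity, hcard, Nat.factorization_mul hp.out.ne_zero hs0.ne',
      Finsupp.add_apply, hp.out.factorization_self, Nat.factorization_eq_zero_of_not_dvd hps]
    simp
  have hidx : (P : Subgroup Γ).index = s := by
    have := (P : Subgroup Γ).card_mul_index
    rw [hcard] at this
    have hP' : Nat.card (P : Subgroup Γ) = p := hP
    rw [hP'] at this
    exact Nat.eq_of_mul_eq_mul_left hp.out.pos this
  refine ⟨?_, hP, hidx⟩
  have h1 : Nat.card (Sylow p Γ) ≤ s := Nat.le_of_dvd hs0 (hidx ▸ P.card_dvd_index)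
  have h2 : Nat.card (Sylow p Γ) = 1 := by
    have h3 := card_sylow_modEq_one p Γ
    rw [Nat.ModEq, Nat.mod_eq_of_lt (by omega), Nat.mod_eq_of_lt hp.out.one_lt] at h3
    exact h3
  have := (Nat.card_eq_one_iff_unique.1 h2).1
  exact P.normal_of_subsingleton

/-- A normal subgroup of prime order `p` has a centralizer of index at most two as soon as
`(p - 1) / 2` is coprime to its index, since the quotient by the centralizer embeds into the
cyclic group of order `p - 1`. -/
theorem index_centralizer_dvd_two {Γ : Type*} [Group Γ] [Finite Γ] {p s : ℕ} (hp : p.Prime)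
    (P : Subgroup Γ) [P.Normal] (hP : Nat.card P = p) (hidx : P.index = s)
    (hcop : Nat.Coprime ((p - 1) / 2) s) : (Subgroup.centralizer (P : Set Γ)).index ∣ 2 := by
  have := Fact.mk hp
  have hcyc : IsCyclic P := isCyclic_of_prime_card hP
  have hcomm : P ≤ Subgroup.centralizer (P : Set Γ) := by
    have := hcyc.isMulCommutative
    exact Subgroup.le_centralizer P
  have h1 : (Subgroup.centralizer (P : Set Γ)).index ∣ s :=
    hidx ▸ Subgroup.index_dvd_of_le hcomm
  have hker : (MulAut.conjNormal (H := P)).ker = Subgroup.centralizer (P : Set Γ) := by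
    ext γ
    rw [MonoidHom.mem_ker, Subgroup.mem_centralizer_iff]
    constructor
    · intro h x hx
      have := congrArg (fun σ : MulAut P => (σ ⟨x, hx⟩ : Γ)) h
      simp only [MulAut.conjNormal_apply, MulAut.one_apply] at this
      rw [mul_inv_eq_iff_eq_mul] at this
      exact this.symm
    · intro h
      ext x
      rw [MulAut.conjNormal_apply, MulAut.one_apply, mul_inv_eq_iff_eq_mul]
      exact (h x x.2).symm
  have h2 : (Subgroup.centralizer (P : Set Γ)).index ∣ p - 1 := by
    rw [← hker, Subgroup.index_ker, ← Nat.totient_prime hp, ← hP, ← IsCyclic.card_mulAut]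
    exact Subgroup.card_subgroup_dvd_card _
  have h3 : p - 1 ∣ 2 * ((p - 1) / 2) ∨ p = 2 := by
    rcases hp.eq_two_or_odd' with h | ⟨k, rfl⟩
    · exact Or.inr h
    · left; simp
  rcases h3 with h3 | rfl
  · exact (Nat.Coprime.dvd_of_dvd_mul_right (hcop.symm.coprime_dvd_left h1)) (h2.trans h3)
  · exact h2.trans (by norm_num)

/-- A finite group with a central subgroup of prime order `p` and of index prime to `p` is not
generated by elements of order prime to `p`: the transfer onto that subgroup has a proper kernel,
which contains all of them. -/
theorem exists_ne_top_of_central {C : Type*} [Group C] [Finite C] {p : ℕ} [hp : Fact p.Prime]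
    (Q : Sylow p C) (hQ : Nat.card Q = p) (hcentral : (Q : Subgroup C) ≤ Subgroup.center C) :
    ∃ K : Subgroup C, K ≠ ⊤ ∧ ∀ c : C, (orderOf c).Coprime p → c ∈ K := by
  have hN : Subgroup.normalizer (Q : Set C) ≤ Subgroup.centralizer (Q : Set C) := by
    intro c _
    rw [Subgroup.mem_centralizer_iff]
    exact fun q hq => ((Subgroup.mem_center_iff.1 (hcentral hq)) c).symm
  refine ⟨(MonoidHom.transferSylow Q hN).ker, ?_, fun c hc => ?_⟩
  · intro htop
    have h1 := (MonoidHom.ker_transferSylow_isComplement' Q hN).card_mul_card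
    rw [htop, Subgroup.card_top] at h1
    have h2 : Nat.card (Q : Subgroup C) = p := hQ
    rw [h2] at h1
    have h3 : Nat.card C ≠ 0 := Nat.card_pos.ne'
    have := hp.out.one_lt
    have : Nat.card C * 1 < Nat.card C * p := Nat.mul_lt_mul_of_pos_left this (Nat.pos_of_ne_zero h3)
    omega
  · rw [MonoidHom.mem_ker, ← orderOf_eq_one_iff]
    refine Nat.eq_one_of_dvd_coprimes hc (orderOf_map_dvd _ c) ?_
    exact (orderOf_dvd_natCard _).trans (dvd_of_eq hQ)

/-! ### The bound for flag-free actions -/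

namespace IsFlagFree

variable {H X Y : Type*} [Group H] [MulAction H X] [MulAction H Y] [Finite H] [Finite X] [Finite Y]
  {ends : Y → Sym2 X}

/-- The Riemann–Hurwitz formula for a flag-free action. -/
theorem riemann_hurwitz (hH : IsFlagFree H ends) [Fintype (orbitRel.Quotient H X)] {T : ℚ}
    (hT : T * Nat.card H = 2 * Nat.card Y - 2 * Nat.card X) :
    T = 2 * hH.numCrossing + hH.numVertical -
      2 * ∑ ω : orbitRel.Quotient H X, 1 / (Nat.card (stabilizer H ω.out) : ℚ) := by
  have h1 : (2 * Nat.card Y : ℚ) = Nat.card H * (2 * hH.numCrossing + hH.numVertical) := by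
    exact_mod_cast hH.two_mul_card_edges
  have h0 : (Nat.card H : ℚ) ≠ 0 := by exact_mod_cast Nat.card_pos.ne'
  rw [h1, card_eq_sum_orbits H X] at hT
  apply mul_right_cancel₀ h0
  rw [hT]
  ring

theorem excess_eq_third (hH : IsFlagFree H ends) {T : ℚ}
    (hT : T * Nat.card H = 2 * Nat.card Y - 2 * Nat.card X) (h0 : 0 < T) (h1 : T < 1 / 2) :
    T = 1 / 3 := by
  have := Fintype.ofFinite (orbitRel.Quotient H X)
  exact HarmonicGraph.excess_eq_third (fun _ => Nat.card_pos) (hH.riemann_hurwitz hT)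
    (Nat.card_eq_fintype_card (α := orbitRel.Quotient H X) ▸ hH.card_orbits_le) h0 h1

/-- A group of small excess is generated by elements of order at most `6`, so it has no central
Sylow subgroup of prime order `p ≥ 7`. -/
theorem no_central_sylow (hH : IsFlagFree H ends) {T : ℚ}
    (hT : T * Nat.card H = 2 * Nat.card Y - 2 * Nat.card X) (h0 : 0 < T) (h1 : T ≤ 2 / 3)
    {p : ℕ} [hp : Fact p.Prime] (hp7 : 7 ≤ p) (Q : Sylow p H) (hQ : Nat.card Q = p)
    (hcentral : (Q : Subgroup H) ≤ Subgroup.center H) : False := by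
  have := Fintype.ofFinite (orbitRel.Quotient H X)
  have hle : Fintype.card (orbitRel.Quotient H X) ≤ hH.numCrossing + 1 :=
    Nat.card_eq_fintype_card (α := orbitRel.Quotient H X) ▸ hH.card_orbits_le
  have hRH := hH.riemann_hurwitz hT
  obtain ⟨htree, hv⟩ := tree_of_excess_lt_one (fun _ => Nat.card_pos) hRH hle h0 (by linarith)
  obtain ⟨K, hK, hmem⟩ := exists_ne_top_of_central Q hQ hcentral
  refine hK (hH.eq_top_of_tree (Nat.card_eq_fintype_card.trans htree) hv K ?_ ?_)
  · intro h x hx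
    have h3 : Nat.card (stabilizer H x) < 7 := by
      have hrel : orbitRel H X x (Quotient.mk (orbitRel H X) x).out :=
        (orbitRel H X).symm' (Quotient.mk_out (s := orbitRel H X) x)
      rw [Nat.card_congr (stabilizerEquivStabilizerOfOrbitRel hrel).toEquiv]
      exact stabilizer_lt_seven (fun _ => Nat.card_pos) hRH hle h0 h1 _
    have h4 : orderOf h ∣ Nat.card (stabilizer H x) :=
      Subgroup.orderOf_dvd_natCard _ (show h ∈ stabilizer H x from hx)
    have h5 := Nat.le_of_dvd Nat.card_pos h4
    exact hmem h ((Nat.coprime_of_lt_prime (orderOf_pos h).ne' (by omega) hp.out).symm)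
  · intro h hh
    have h5 := Nat.le_of_dvd (by norm_num) (orderOf_dvd_of_pow_eq_one hh)
    exact hmem h ((Nat.coprime_of_lt_prime (orderOf_pos h).ne' (by omega) hp.out).symm)

/-- The bound `|Γ| ≤ 4 (g - 1)` for abstract flag-free actions. -/
theorem card_le (hH : IsFlagFree H ends) {g₁ p : ℕ} (hg₁ : 1 < g₁) (hp : p.Prime)
    (hlarge : 6 * (g₁ - 1) < p) (hcop : Nat.Coprime ((p - 1) / 2) (Nat.factorial (g₁ + 1)))
    (hgenus : (Nat.card Y : ℚ) - Nat.card X = p * (g₁ - 1 : ℕ)) :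
    Nat.card H ≤ 4 * (p * (g₁ - 1)) := by
  by_contra! hlt
  have := Fact.mk hp
  set a := g₁ - 1 with ha
  have ha0 : 0 < a := by omega
  have hn : (0 : ℚ) < Nat.card H := by exact_mod_cast Nat.card_pos
  have hpa : (0 : ℚ) < p * a := by exact_mod_cast Nat.mul_pos hp.pos ha0
  have hlt' : 4 * ((p : ℚ) * a) < Nat.card H := by exact_mod_cast hlt
  have hT : (2 * (p * a) / Nat.card H : ℚ) * Nat.card H = 2 * Nat.card Y - 2 * Nat.card X := by
    rw [div_mul_cancel₀ _ hn.ne']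
    linarith
  -- the excess is below `1/2`, hence equal to `1/3`, so that the order is `6 (g - 1)`
  have hthird := hH.excess_eq_third hT (by positivity) (by rw [div_lt_iff₀ hn]; linarith)
  rw [div_eq_iff hn.ne'] at hthird
  have hcard : Nat.card H = p * (6 * a) := by
    have : (Nat.card H : ℚ) = p * (6 * a) := by linarith
    exact_mod_cast this
  obtain ⟨P⟩ : Nonempty (Sylow p H) := inferInstance
  obtain ⟨hPn, hPc, hPi⟩ := sylow_normal_of_card_eq (by omega) hlarge hcard P
  -- every prime factor of `6 (g₁ - 1)` divides `(g₁ + 1)!`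
  have hcop' : Nat.Coprime ((p - 1) / 2) (6 * a) := by
    have h6 : 6 ∣ Nat.factorial (g₁ + 1) :=
      Nat.factorial_dvd_factorial (show 3 ≤ g₁ + 1 by omega)
    exact (hcop.coprime_dvd_right h6).mul_right
      (hcop.coprime_dvd_right (Nat.dvd_factorial ha0 (by omega)))
  -- the centralizer has excess `1/3` or `2/3`, and contains the Sylow subgroup in its centre
  set C := Subgroup.centralizer ((P : Subgroup H) : Set H)
  have hC2 : C.index ∣ 2 := index_centralizer_dvd_two hp (P : Subgroup H) hPc hPi hcop'
  have hPC : (P : Subgroup H) ≤ C := by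
    have hcyc : IsCyclic P := isCyclic_of_prime_card hPc
    have := hcyc.isMulCommutative
    exact Subgroup.le_centralizer (P : Subgroup H)
  have hC := hH.subgroup C
  have hCcard : Nat.card C * C.index = p * (6 * a) := hcard ▸ C.card_mul_index
  have hCcard' : (Nat.card C : ℚ) * C.index = p * (6 * a) := by exact_mod_cast hCcard
  have hidx : (C.index : ℚ) ≤ 2 := by exact_mod_cast Nat.le_of_dvd (by norm_num) hC2
  have hCn : (0 : ℚ) < Nat.card C := by exact_mod_cast Nat.card_pos
  have hTC : (2 * (p * a) / Nat.card C : ℚ) * Nat.card C = 2 * Nat.card Y - 2 * Nat.card X := by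
    rw [div_mul_cancel₀ _ hCn.ne']
    linarith
  refine hC.no_central_sylow hTC (by positivity) ?_ (p := p) (by omega) (P.subtype hPC) ?_ ?_
  · rw [div_le_iff₀ hCn]
    nlinarith
  · exact (Nat.card_congr (Subgroup.subgroupOfEquivOfLe hPC).toEquiv).trans hPc
  · intro x hx
    rw [Subgroup.mem_center_iff]
    intro c
    exact Subtype.ext (Subgroup.mem_centralizer_iff.1 c.2 x hx).symm

end IsFlagFree

/-! ### Harmonic actions are flag-free -/

section Graph

variable {V E : Type*} {G : Graph V E}

theorem exists_ends (e : G.edgeSet) :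
    ∃ z : Sym2 G.vertexSet, ∀ x y : G.vertexSet, G.IsLink e x y ↔ z = s(x, y) := by
  obtain ⟨a, b, hab⟩ := G.exists_isLink_of_mem_edgeSet e.2
  refine ⟨s(⟨a, hab.left_mem⟩, ⟨b, hab.right_mem⟩), fun x y => ?_⟩
  rw [hab.isLink_iff, Sym2.eq_iff, Subtype.ext_iff, Subtype.ext_iff, Subtype.ext_iff,
    Subtype.ext_iff]

/-- The unordered pair of ends of an edge. -/
noncomputable def edgeEnds (e : G.edgeSet) : Sym2 G.vertexSet := (exists_ends e).choose

theorem isLink_iff_edgeEnds {e : G.edgeSet} {x y : G.vertexSet} :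
    G.IsLink e x y ↔ edgeEnds e = s(x, y) :=
  (exists_ends e).choose_spec x y

theorem mem_edgeEnds {e : G.edgeSet} {x : G.vertexSet} : x ∈ edgeEnds e ↔ G.Inc e x := by
  constructor
  · rintro ⟨y, hy⟩
    exact ⟨y, isLink_iff_edgeEnds.2 hy⟩
  · rintro ⟨y, hy⟩
    exact ⟨⟨y, hy.right_mem⟩, isLink_iff_edgeEnds.1 hy⟩

theorem edgeEnds_smul (γ : Aut G) (e : G.edgeSet) :
    edgeEnds (γ • e) = (edgeEnds e).map (γ • ·) := by
  obtain ⟨⟨x, y⟩, hz⟩ := Quot.exists_rep (edgeEnds e)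
  have hz' : edgeEnds e = s(x, y) := hz.symm
  rw [hz', Sym2.map_mk]
  exact isLink_iff_edgeEnds.1 ((isLink_smul γ e x y).2 (isLink_iff_edgeEnds.2 hz'))

theorem inc_smul {γ : Aut G} {e : G.edgeSet} {x : G.vertexSet} (h : G.Inc e x) :
    G.Inc (γ • e : G.edgeSet) (γ • x : G.vertexSet) := by
  obtain ⟨y, hy⟩ := h
  exact ⟨_, (isLink_smul γ e x ⟨y, hy.right_mem⟩).2 hy⟩

theorem vertexOrbit_zpowers_eq {γ : Aut G} {x y : G.vertexSet} (hx : γ • x = x)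
    (h : vertexOrbit (Subgroup.zpowers γ) y = vertexOrbit (Subgroup.zpowers γ) x) : y = x := by
  obtain ⟨⟨δ, hδ⟩, h⟩ := Quotient.exact h
  have h' : δ • x = y := h
  have : δ ∈ MulAction.stabilizer (Aut G) x :=
    (Subgroup.zpowers_le.2 (show γ ∈ MulAction.stabilizer (Aut G) x from hx)) hδ
  exact h'.symm.trans this

/-- If an automorphism fixes a flag at `x` and the quotient map by the group it generates is
harmonic, then it fixes all edges at `x`: these edges have singleton fibres at `x`, because the
fixed edge has. -/
theorem smul_edge_eq_of_flag [G.Loopless] (hV : G.vertexSet.Finite) (hE : G.edgeSet.Finite)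
    {γ : Aut G}
    (hharm : (quotientMap (Subgroup.zpowers γ)).IsHarmonic) {x : G.vertexSet} {e f : G.edgeSet}
    (hx : γ • x = x) (he : γ • e = e) (hex : G.Inc e x) (hfx : G.Inc f x) : γ • f = f := by
  classical
  set Δ := Subgroup.zpowers γ
  -- no edge at `x` is contracted, since the orbit of `x` is a single vertex
  have hlink : ∀ f : G.edgeSet, G.Inc f x →
      ∃ Y, (quotientGraph Δ).IsLink (edgeOrbit Δ f) (vertexOrbit Δ x) Y := by
    rintro f ⟨y, hy⟩
    refine ⟨vertexOrbit Δ ⟨y, hy.right_mem⟩, ?_, f, x, ⟨y, hy.right_mem⟩, hy, rfl, rfl, rfl⟩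
    intro h
    have := vertexOrbit_zpowers_eq hx h.symm
    exact hy.ne (congrArg Subtype.val this).symm
  have hmem : ∀ f : G.edgeSet, G.Inc f x → edgeOrbit Δ f ∈ (quotientGraph Δ).edgeSet :=
    fun f hf => (hlink f hf).choose_spec.edge_mem
  have himg : ∀ (f k : G.edgeSet) (hf : G.Inc f x), edgeOrbit Δ k = edgeOrbit Δ f →
      (quotientMap Δ).onEdge k = Sum.inr ⟨edgeOrbit Δ f, hmem f hf⟩ := by
    intro f k hf hk
    have : edgeOrbit Δ k ∈ (quotientGraph Δ).edgeSet := hk ▸ hmem f hf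
    simp only [quotientMap, hmem f hf, hk, dif_pos]
  have hcount := hharm x ⟨edgeOrbit Δ e, hmem e hex⟩ ⟨edgeOrbit Δ f, hmem f hfx⟩
    (hlink e hex) (hlink f hfx)
  have hone : (quotientMap Δ).toFun ⁻¹' {Sum.inr ⟨edgeOrbit Δ e, hmem e hex⟩} ∩ star G x ⊆
      {Sum.inr e} := by
    rintro (y | k) ⟨h1, h2⟩
    · simp [Morphism.toFun] at h1
    · have hk : G.Inc k x := by
        rcases h2 with ⟨y, -, hy⟩ | ⟨k', hk', h⟩
        · cases hy
        · cases h
          exact hk'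
      have h3 : (quotientMap Δ).onEdge k = Sum.inr ⟨edgeOrbit Δ e, hmem e hex⟩ := h1
      rw [himg k k hk rfl] at h3
      have h4 : edgeOrbit Δ k = edgeOrbit Δ e := congrArg Subtype.val (Sum.inr_injective h3)
      obtain ⟨⟨δ, hδ⟩, h⟩ := Quotient.exact h4
      have h' : δ • e = k := h
      have h5 : δ ∈ MulAction.stabilizer (Aut G) e :=
        (Subgroup.zpowers_le.2 (show γ ∈ MulAction.stabilizer (Aut G) e from he)) hδ
      have h6 : k = e := h'.symm.trans h5
      rw [h6, Set.mem_singleton_iff]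
  have hle := (Set.ncard_le_ncard hone (Set.finite_singleton _)).trans_eq (Set.ncard_singleton _)
  rw [hcount] at hle
  have hfin : Finite G.edgeSet := hE
  have hfin' : Finite G.vertexSet := hV
  have hstar : (star G x).Finite := Set.toFinite _
  have hin : ∀ k : G.edgeSet, G.Inc k x → edgeOrbit Δ k = edgeOrbit Δ f →
      (Sum.inr k : G.vertexSet ⊕ G.edgeSet) ∈
        (quotientMap Δ).toFun ⁻¹' {Sum.inr ⟨edgeOrbit Δ f, hmem f hfx⟩} ∩ star G x :=
    fun k hk hkf => ⟨himg f k hfx hkf, Or.inr ⟨k, hk, rfl⟩⟩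
  have hγf : edgeOrbit Δ (γ • f) = edgeOrbit Δ f :=
    Quotient.sound ⟨⟨γ, Subgroup.mem_zpowers γ⟩, rfl⟩
  have hγfx : G.Inc (γ • f : G.edgeSet) x := by
    have := inc_smul (γ := γ) hfx
    rwa [hx] at this
  exact Sum.inr_injective ((Set.ncard_le_one (hstar.inter_of_right _)).1 hle _ (hin _ hγfx hγf) _
    (hin f hfx rfl))

/-- In a connected graph the property of fixing a vertex and all edges at it propagates. -/
theorem eq_one_of_fixes_flag [G.Loopless] (hV : G.vertexSet.Finite) (hE : G.edgeSet.Finite)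
    (hconn : G.toSimpleGraph.Connected) {γ : Aut G}
    (hharm : (quotientMap (Subgroup.zpowers γ)).IsHarmonic) {x : G.vertexSet} {e : G.edgeSet}
    (hx : γ • x = x) (he : γ • e = e) (hex : G.Inc e x) : γ = 1 := by
  have hall : ∀ y : G.vertexSet, γ • y = y ∧ ∀ f : G.edgeSet, G.Inc f y → γ • f = f := by
    intro y
    obtain ⟨w⟩ := hconn.preconnected x y
    induction w generalizing e with
    | nil => exact ⟨hx, fun f hf => smul_edge_eq_of_flag hV hE hharm hx he hex hf⟩
    | @cons u v t huv w ih =>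
      obtain ⟨f, hf⟩ := (Graph.toSimpleGraph_adj_iff u v).1 huv
      have hfix : γ • (⟨f, hf.edge_mem⟩ : G.edgeSet) = ⟨f, hf.edge_mem⟩ :=
        smul_edge_eq_of_flag hV hE hharm hx he hex hf.inc_left
      have h1 := (isLink_smul γ ⟨f, hf.edge_mem⟩ u v).2 hf
      rw [hfix, hx] at h1
      exact ih (e := ⟨f, hf.edge_mem⟩) (Subtype.ext (h1.right_unique hf)) hfix hf.inc_right
  refine Subtype.ext (Prod.ext (Equiv.ext fun y => (hall y).1) (Equiv.ext fun f => ?_))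
  obtain ⟨a, b, hab⟩ := G.exists_isLink_of_mem_edgeSet f.2
  exact (hall ⟨a, hab.left_mem⟩).2 f hab.inc_left

theorem isFlagFree_of_actsHarmonically [G.Loopless] (hV : G.vertexSet.Finite) (hE : G.edgeSet.Finite)
    (hconn : G.toSimpleGraph.Connected) {Γ : Subgroup (Aut G)} (hΓ : ActsHarmonically Γ) :
    IsFlagFree Γ (edgeEnds (G := G)) where
  ends_smul γ e := edgeEnds_smul γ.1 e
  not_isDiag e h := by
    obtain ⟨⟨x, y⟩, hz⟩ := Quot.exists_rep (edgeEnds e)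
    have hz' : edgeEnds e = s(x, y) := hz.symm
    have hl := isLink_iff_edgeEnds.2 hz'
    rw [hz', Sym2.mk_isDiag_iff] at h
    exact hl.ne (congrArg Subtype.val h)
  eq_one γ x e hx hγx hγe := Subtype.ext <|
    eq_one_of_fixes_flag hV hE hconn (hΓ _ (Subgroup.zpowers_le.2 γ.2)).1 hγx hγe
      (mem_edgeEnds.1 hx)
  connected := by
    refine hconn.mono fun x y hxy => ?_
    obtain ⟨e, he⟩ := (Graph.toSimpleGraph_adj_iff x y).1 hxy
    exact ⟨⟨⟨e, he.edge_mem⟩, isLink_iff_edgeEnds.1 he⟩, hxy.ne⟩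

end Graph

end HarmonicGraph

theorem mainTheorem4 {V E : Type*} (G : Graph V E)
    (hV : G.vertexSet.Finite) (hE : G.edgeSet.Finite)
    (hloopless : G.Loopless) (hconn : G.toSimpleGraph.Connected)
    (g₁ p g : ℕ) (hg₁ : 1 < g₁) (hp : p.Prime)
    (hlarge : 6 * (g₁ - 1) < p)
    (hcop : Nat.Coprime ((p - 1) / 2) (Nat.factorial (g₁ + 1)))
    (hg : g = p * (g₁ - 1) + 1)
    (hgenus : HarmonicGraph.genus G = (g : ℤ))
    (Γ : Subgroup (HarmonicGraph.Aut G))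
    (hΓ : HarmonicGraph.ActsHarmonically Γ)
    (hdvd : p ∣ Nat.card Γ) :
    Nat.card Γ ≤ 4 * (g - 1) := by
  have hX : Finite G.vertexSet := hV
  have hY : Finite G.edgeSet := hE
  have hfree := HarmonicGraph.isFlagFree_of_actsHarmonically hV hE hconn hΓ
  rw [hg, Nat.add_sub_cancel]
  refine hfree.card_le hg₁ hp hlarge hcop ?_
  rw [HarmonicGraph.genus, hg, ← Nat.card_coe_set_eq, ← Nat.card_coe_set_eq] at hgenus
  have h : (Nat.card G.edgeSet : ℤ) - Nat.card G.vertexSet = (p * (g₁ - 1 : ℕ) : ℕ) := by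
    push_cast at hgenus ⊢
    linarith
  exact_mod_cast h
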